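/- Let $d\ge 1$ and consider the Anderson model $H_\omega=-\Delta+V_\omega$ on $\ell^2(\mathbb Z^d)$. Here $(\Delta\varphi)(x)=\sum_{y:\,|x-y|=1}\varphi(y)$, where $|\cdot|$ is the Euclidean norm, and $V_\omega$ acts by multiplication by the real-valued random potential $\{V_\omega(x): x\in\mathbb Z^d\}$, on its natural domain $\{\varphi\in\ell^2(\mathbb Z^d): V_\omega\varphi\in\ell^2(\mathbb Z^d)\}$. The random variables $V_\omega(x)$, $x\in\mathbb Z^d$, are independent and identically distributed, and their common distribution $\mu$ has a bounded density $\rho$ with respect to Lebesgue measure. Call $\varphi\in\ell^2(\mathbb Z^d)$ fast decaying if there are $\beta>\frac{5d}{2}$ and $C_\varphi<\infty$ such that $|\varphi(x)|\le C_\varphi\langle x\rangle^{-\beta}$ for all $x\in\mathbb Z^d$, where $\langle x\rangle=\sqrt{1+|x|^2}$. Then, with probability one, $H_\omega$ has no eigenvalue with two linearly independent fast decaying eigenfunctions. That is, for almost every $\omega$ there do not exist $E$ and two linearly independent fast decaying functions $\varphi_1,\varphi_2$ in the domain of $H_\omega$ with $H_\omega\varphi_1=E\varphi_1$ and $H_\omega\varphi_2=E\varphi_2$.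 -/

import Mathlib

open MeasureTheory ProbabilityTheory
open scoped ENNReal NNReal

noncomputable section

namespace Anderson

/-- The lattice `ℤ^d`. -/
abbrev Lattice (d : ℕ) : Type := Fin d → ℤ

/-- The Euclidean norm `|x|` of a lattice point (not the sup norm that `Fin d → ℤ` carries). -/
def euclNorm {d : ℕ} (x : Lattice d) : ℝ := √(∑ i, (x i : ℝ) ^ 2)

/-- `⟨x⟩ = √(1 + |x|²)`. -/
def bracket {d : ℕ} (x : Lattice d) : ℝ := √(1 + euclNorm x ^ 2)

/-- The Hilbert space `ℓ²(ℤ^d)` of complex square-summable functions. -/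
abbrev L2 (d : ℕ) : Type := lp (fun _ : Lattice d => ℂ) 2

open Classical in
/-- The kernel of the lattice Laplacian: `Δ(x,y) = 1` if `|x - y| = 1`, and zero otherwise. -/
def lapKernel {d : ℕ} (x y : Lattice d) : ℂ := if euclNorm (x - y) = 1 then 1 else 0

/-- `(Δφ)(x) = ∑_y Δ(x,y) φ(y)`; only the `2d` nearest neighbours of `x` contribute. -/
def lapFun {d : ℕ} (φ : Lattice d → ℂ) (x : Lattice d) : ℂ := ∑' y, lapKernel x y * φ y

/-- The `2d` unit vectors `± e_i`. -/
def unitVec {d : ℕ} (p : Fin d × Bool) : Lattice d := Pi.single p.1 (if p.2 then 1 else -1)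

theorem unitVec_injective {d : ℕ} : Function.Injective (unitVec (d := d)) := by
  rintro ⟨i, b⟩ ⟨j, c⟩ h
  have hi := congrFun h i
  by_cases hij : i = j
  · subst hij
    cases b <;> cases c <;> simp [unitVec] at hi ⊢
  · exfalso
    cases b <;> simp [unitVec, hij] at hi

theorem euclNorm_eq_one_iff {d : ℕ} (z : Lattice d) :
    euclNorm z = 1 ↔ ∃ p, z = unitVec p := by
  have key : euclNorm z = 1 ↔ ∑ i, z i ^ 2 = 1 := by
    unfold euclNorm
    rw [Real.sqrt_eq_one]
    exact_mod_cast Iff.rfl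
  rw [key]
  constructor
  · intro h
    have hne : ∃ i, z i ≠ 0 := by
      by_contra! hz
      simp [hz] at h
    obtain ⟨i, hi⟩ := hne
    have hsplit := Finset.add_sum_erase Finset.univ (fun j => z j ^ 2) (Finset.mem_univ i)
    have hpos : 1 ≤ z i ^ 2 := by
      have : 0 < z i ^ 2 := by positivity
      omega
    have hnn : ∀ j ∈ Finset.univ.erase i, 0 ≤ z j ^ 2 := fun j _ => sq_nonneg _
    have h0 : ∑ j ∈ Finset.univ.erase i, z j ^ 2 = 0 := by
      have := Finset.sum_nonneg hnn
      omega
    have hzi : z i ^ 2 = 1 := by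
      omega
    have hz : ∀ j, j ≠ i → z j = 0 := by
      intro j hj
      have := (Finset.sum_eq_zero_iff_of_nonneg hnn).1 h0 j (by simp [hj])
      simpa using this
    rcases (show z i = 1 ∨ z i = -1 by simpa using hzi) with h1 | h1
    · refine ⟨(i, true), ?_⟩
      ext j
      by_cases hj : j = i
      · subst hj; simp [unitVec, h1]
      · simp [unitVec, hz j hj, hj]
    · refine ⟨(i, false), ?_⟩
      ext j
      by_cases hj : j = i
      · subst hj; simp [unitVec, h1]
      · simp [unitVec, hz j hj, hj]
  · rintro ⟨⟨i, b⟩, rfl⟩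
    rw [Finset.sum_eq_single i]
    · cases b <;> simp [unitVec]
    · intro j _ hj
      simp [unitVec, hj]
    · simp

theorem lapFun_eq_sum {d : ℕ} (φ : Lattice d → ℂ) (x : Lattice d) :
    lapFun φ x = ∑ p, φ (x - unitVec p) := by
  have hinj : Function.Injective (fun p : Fin d × Bool => x - unitVec p) := fun p q h =>
    unitVec_injective (by simpa using h)
  unfold lapFun
  rw [← hinj.tsum_eq, tsum_fintype]
  · refine Finset.sum_congr rfl fun p _ => ?_
    have : euclNorm (unitVec p) = 1 := (euclNorm_eq_one_iff _).2 ⟨p, rfl⟩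
    simp [lapKernel, this]
  · intro y hy
    have h1 : euclNorm (x - y) = 1 := by
      by_contra h
      simp [lapKernel, h] at hy
    obtain ⟨p, hp⟩ := (euclNorm_eq_one_iff _).1 h1
    exact ⟨p, by simp [← hp]⟩

theorem memℓp_shift {d : ℕ} (φ : L2 d) (v : Lattice d) :
    Memℓp (fun x : Lattice d => φ (x - v)) 2 := by
  have h := lp.memℓp φ
  rw [memℓp_gen_iff (by norm_num)] at h ⊢
  exact (Equiv.subRight v).summable_iff.2 h

theorem memℓp_lapFun {d : ℕ} (φ : L2 d) : Memℓp (lapFun φ) 2 := by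
  have h : lapFun φ = ∑ p, fun x : Lattice d => φ (x - unitVec p) := by
    ext x
    simp [lapFun_eq_sum]
  rw [h]
  exact (lpSubmodule ℂ (fun _ : Lattice d => ℂ) 2).sum_mem fun p _ => memℓp_shift φ _

/-- The lattice Laplacian `Δ`, an everywhere defined operator on `ℓ²(ℤ^d)`. -/
def laplacian (d : ℕ) : L2 d →ₗ[ℂ] L2 d where
  toFun φ := ⟨lapFun φ, memℓp_lapFun φ⟩
  map_add' φ ψ := by
    ext x
    change lapFun (φ + ψ : L2 d) x = lapFun φ x + lapFun ψ x
    rw [lapFun_eq_sum, lapFun_eq_sum, lapFun_eq_sum, ← Finset.sum_add_distrib]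
    rfl
  map_smul' c φ := by
    ext x
    simp [lapFun_eq_sum, Finset.mul_sum]

/-- Multiplication by the real potential `V`, on its natural (maximal) domain
`{φ ∈ ℓ²(ℤ^d) | Vφ ∈ ℓ²(ℤ^d)}`. The potential may be unbounded. -/
def potential {d : ℕ} (V : Lattice d → ℝ) : L2 d →ₗ.[ℂ] L2 d where
  domain :=
    { carrier := {φ | Memℓp (fun x => (V x : ℂ) * φ x) 2}
      add_mem' := fun {φ ψ} hφ hψ => by
        have := Memℓp.add hφ hψ
        refine (congrArg (Memℓp · 2) ?_).mp this
        ext x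
        simp [mul_add]
      zero_mem' := by
        refine (congrArg (Memℓp · 2) ?_).mp (zero_memℓp (E := fun _ : Lattice d => ℂ))
        ext x
        simp
      smul_mem' := fun c φ hφ => by
        have := Memℓp.const_smul hφ c
        refine (congrArg (Memℓp · 2) ?_).mp this
        ext x
        simp [mul_left_comm] }
  toFun :=
    { toFun := fun φ => ⟨fun x => (V x : ℂ) * (φ : L2 d) x, φ.2⟩
      map_add' := fun φ ψ => by
        ext x
        change (V x : ℂ) * ((φ : L2 d) x + (ψ : L2 d) x) =
          (V x : ℂ) * (φ : L2 d) x + (V x : ℂ) * (ψ : L2 d) x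
        ring
      map_smul' := fun c φ => by
        ext x
        simp [mul_left_comm] }

/-- The Schrödinger operator `H = -Δ + V` on `ℓ²(ℤ^d)`, with domain the domain of `V`. -/
def hamiltonian {d : ℕ} (V : Lattice d → ℝ) : L2 d →ₗ.[ℂ] L2 d :=
  (-laplacian d).toPMap ⊤ + potential V

/-- `φ` is an eigenfunction of the (possibly unbounded) operator `H` with eigenvalue `E`. -/
def IsEigenfunction {d : ℕ} (H : L2 d →ₗ.[ℂ] L2 d) (E : ℂ) (φ : L2 d) : Prop :=
  φ ≠ 0 ∧ ∃ h : φ ∈ H.domain, H ⟨φ, h⟩ = E • φ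

/-- `φ` has `β`-decay: `|φ(x)| ≤ C ⟨x⟩^{-β}` for some finite constant `C`. -/
def HasDecay {d : ℕ} (β : ℝ) (φ : L2 d) : Prop :=
  ∃ C : ℝ, ∀ x, ‖φ x‖ ≤ C * bracket x ^ (-β)

/-- `φ` is fast decaying: it has `β`-decay for some `β > 5d/2`. -/
def FastDecaying {d : ℕ} (φ : L2 d) : Prop :=
  ∃ β : ℝ, 5 * (d : ℝ) / 2 < β ∧ HasDecay β φ

/-- `V` is an Anderson potential: the `V x`, `x ∈ ℤ^d`, are independent identically distributed
real random variables, whose common distribution `μ` has a bounded density `ρ`. -/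
structure IsAndersonPotential {d : ℕ} {Ω : Type*} [MeasurableSpace Ω] (P : Measure Ω)
    (V : Lattice d → Ω → ℝ) (μ : Measure ℝ) (ρ : ℝ → ℝ≥0∞) : Prop where
  measurable : ∀ x, Measurable (V x)
  indep : iIndepFun V P
  law : ∀ x, P.map (V x) = μ
  measurable_density : Measurable ρ
  density : μ = volume.withDensity ρ
  bounded : ∃ M : ℝ≥0, ∀ᵐ t, ρ t ≤ M

end Anderson

end

/-!
Almost surely every eigenvalue of the Anderson Hamiltonian is simple, because the law of each `V x`
has no atoms.

If `E` is an eigenvalue with two linearly independent eigenfunctions, pick `x` where the first one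
does not vanish. Normalizing it and subtracting a multiple of it from the second gives
eigenfunctions `φ`, `ψ` with `φ x = 1`, `ψ x = 0`, `ψ ≠ 0`
(`Anderson.exists_mem_degenerateAt`). Fix the potential off `x` and consider the set of values `v`
at `x` for which such a triple `(E, φ, ψ)` exists. This set is countable
(`Anderson.countable_setOf_mem_degenerateAt`):

* two values `v ≠ w` cannot share the energy `E`, since Green's identity for the two functions `φ`
  reduces to `v - w = 0` (`Anderson.eq_at_of_solvesEigenEquation`);
* each `ψ` vanishes at `x`, so it solves its equation for every value of the potential at `x`; with
  distinct energies, these `ψ` are mutually orthogonal, and `ℓ²(ℤ^d)` is separable.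

As `V x` is independent of the rest of the potential and its law has no atoms, Fubini's theorem
shows that the degenerate potentials at `x` are null (`Anderson.ae_notMem_degenerateAt`), and there
are countably many `x`. Fubini needs measurability of the degenerate set: bounded energies and
bounded sets of `ℓ²` are compact for pointwise convergence, and the equations are closed conditions
on the potential, the energy and the functions, so the degenerate set is a countable union of
closed sets (`Anderson.measurableSet_degenerateAt`).
-/

open MeasureTheory ProbabilityTheory
open scoped ENNReal NNReal ComplexConjugate

namespace Anderson

variable {d : ℕ}

/-! ### The eigenvalue equation and Green's identity -/

/-- `φ` solves the difference equation `-Δφ + Vφ = Eφ` at every lattice point. -/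
def SolvesEigenEquation (V : Lattice d → ℝ) (E : ℂ) (φ : Lattice d → ℂ) : Prop :=
  ∀ x, -lapFun φ x + V x * φ x = E * φ x

theorem IsEigenfunction.solvesEigenEquation {V : Lattice d → ℝ} {E : ℂ} {φ : L2 d}
    (h : IsEigenfunction (hamiltonian V) E φ) : SolvesEigenEquation V E φ := by
  obtain ⟨-, hφ, h⟩ := h
  intro x
  exact congrArg (fun f : L2 d => f x) h

theorem SolvesEigenEquation.sub_smul {V : Lattice d → ℝ} {E : ℂ} {φ ψ : Lattice d → ℂ}
    (hφ : SolvesEigenEquation V E φ) (hψ : SolvesEigenEquation V E ψ) (c : ℂ) :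
    SolvesEigenEquation V E (ψ - c • φ) := by
  intro x
  have h₁ := hφ x
  have h₂ := hψ x
  have h₃ : lapFun (ψ - c • φ) x = lapFun ψ x - c * lapFun φ x := by
    simp [lapFun_eq_sum, Finset.mul_sum]
  rw [h₃]
  simp only [Pi.sub_apply, Pi.smul_apply, smul_eq_mul]
  linear_combination h₂ - c * h₁

theorem SolvesEigenEquation.smul {V : Lattice d → ℝ} {E : ℂ} {φ : Lattice d → ℂ}
    (hφ : SolvesEigenEquation V E φ) (c : ℂ) : SolvesEigenEquation V E (c • φ) := by
  intro x
  have h₁ := hφ x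
  have h₃ : lapFun (c • φ) x = c * lapFun φ x := by
    simp [lapFun_eq_sum, Finset.mul_sum]
  rw [h₃]
  simp only [Pi.smul_apply, smul_eq_mul]
  linear_combination c * h₁

theorem SolvesEigenEquation.congr_potential {V W : Lattice d → ℝ} {E : ℂ} {φ : Lattice d → ℂ}
    (h : SolvesEigenEquation V E φ) (hVW : ∀ y, φ y ≠ 0 → V y = W y) :
    SolvesEigenEquation W E φ := by
  intro y
  by_cases hy : φ y = 0
  · simpa [hy] using h y
  · rw [← hVW y hy]
    exact h y

/-- The Laplacian is symmetric: a shift by `u` is adjoint to the shift by `-u`, and the set of unit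
vectors is invariant under negation. -/
theorem inner_laplacian_comm (φ ψ : L2 d) :
    inner ℂ ψ (laplacian d φ) = inner ℂ (laplacian d ψ) φ := by
  have hshift (χ : L2 d) : laplacian d χ = ∑ p, (⟨_, memℓp_shift χ (unitVec p)⟩ : L2 d) := by
    ext x
    rw [lp.coeFn_sum, Finset.sum_apply]
    exact lapFun_eq_sum χ x
  -- `e` exchanges `e_i` and `-e_i`.
  let e : Fin d × Bool ≃ Fin d × Bool := (Equiv.refl _).prodCongr Equiv.boolNot
  have he (p) : unitVec (e p) = -unitVec p := by
    obtain ⟨i, b⟩ := p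
    cases b <;> simp [e, unitVec, ← Pi.single_neg]
  rw [hshift, hshift, inner_sum, sum_inner, ← e.sum_comp]
  refine Finset.sum_congr rfl fun p _ => ?_
  rw [lp.inner_eq_tsum, lp.inner_eq_tsum, ← (Equiv.subRight (unitVec p)).tsum_eq]
  simp [he]

/-- Green's identity for two `ℓ²` solutions of eigenvalue equations with different potentials and
different energies. All uses of self-adjointness go through it. -/
theorem hasSum_green {V W : Lattice d → ℝ} {E F : ℂ} {φ ψ : L2 d}
    (hφ : SolvesEigenEquation V E φ) (hψ : SolvesEigenEquation W F ψ) :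
    HasSum (fun x => (((V x : ℂ) - W x) - (E - conj F)) * (conj (ψ x) * φ x)) 0 := by
  have h₁ : HasSum (fun x => inner ℂ (ψ x) (laplacian d φ x)) (inner ℂ ψ (laplacian d φ)) :=
    lp.hasSum_inner _ _
  have h₂ : HasSum (fun x => inner ℂ (laplacian d ψ x) (φ x)) (inner ℂ (laplacian d ψ) φ) :=
    lp.hasSum_inner _ _
  have h := h₁.sub h₂
  rw [inner_laplacian_comm, sub_self] at h
  suffices hx : ∀ x, (((V x : ℂ) - W x) - (E - conj F)) * (conj (ψ x) * φ x) =
      inner ℂ (ψ x) (laplacian d φ x) - inner ℂ (laplacian d ψ x) (φ x) by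
    rw [funext hx]
    exact h
  intro x
  have hφx : -laplacian d φ x + V x * φ x = E * φ x := hφ x
  have hψx : -laplacian d ψ x + W x * ψ x = F * ψ x := hψ x
  have hΔφ : laplacian d φ x = (V x - E) * φ x := by linear_combination -hφx
  have hΔψ : laplacian d ψ x = (W x - F) * ψ x := by linear_combination -hψx
  rw [RCLike.inner_apply, RCLike.inner_apply, hΔφ, hΔψ]
  simp only [map_mul, map_sub, Complex.conj_ofReal]
  ring

/-- Solutions with the same potential satisfy `(E - conj F) ⟪ψ, φ⟫ = 0`. -/
theorem inner_eq_zero_of_solvesEigenEquation {V : Lattice d → ℝ} {E F : ℂ} {φ ψ : L2 d}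
    (hφ : SolvesEigenEquation V E φ) (hψ : SolvesEigenEquation V F ψ) (hEF : E ≠ conj F) :
    inner ℂ ψ φ = 0 := by
  have h₁ := hasSum_green hφ hψ
  have h₂ := (lp.hasSum_inner ψ φ).mul_left (-(E - conj F))
  have h₃ : (fun x => -(E - conj F) * inner ℂ (ψ x) (φ x)) =
      fun x => (((V x : ℂ) - V x) - (E - conj F)) * (conj (ψ x) * φ x) := by
    ext x
    rw [RCLike.inner_apply]
    ring
  rw [h₃] at h₂
  exact (mul_eq_zero.1 (h₂.unique h₁)).resolve_left (neg_ne_zero.2 (sub_ne_zero.2 hEF))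

theorem conj_eq_of_solvesEigenEquation {V : Lattice d → ℝ} {E : ℂ} {φ : L2 d}
    (hφ : SolvesEigenEquation V E φ) (h0 : φ ≠ 0) : conj E = E := by
  by_contra h
  exact h0 (inner_self_eq_zero.1 (inner_eq_zero_of_solvesEigenEquation hφ hφ (Ne.symm h)))

/-- If the potentials `V` and `W` agree off `x` and have a common energy `E` with `ℓ²` solutions
not vanishing at `x`, then `V = W`. -/
theorem eq_at_of_solvesEigenEquation {V W : Lattice d → ℝ} {E : ℂ} {φ ψ : L2 d} {x : Lattice d}
    (hφ : SolvesEigenEquation V E φ) (hψ : SolvesEigenEquation W E ψ)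
    (hVW : ∀ y, y ≠ x → V y = W y) (hφx : φ x ≠ 0) (hψx : ψ x ≠ 0) : V x = W x := by
  have hE : conj E = E := conj_eq_of_solvesEigenEquation hφ (by rintro rfl; simp at hφx)
  have h₁ := hasSum_green hφ hψ
  have h₂ := h₁.unique (hasSum_single x fun y hy => by simp [hVW y hy, hE])
  have h₃ : ((V x : ℂ) - W x) = 0 := by
    simpa [hE, hφx, hψx] using h₂.symm
  exact_mod_cast sub_eq_zero.1 h₃

/-! ### Degenerate potentials -/

/-- Bessel's inequality at each `δ_y` shows that only countably many members of the family are
nonzero at `y`. -/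
theorem countable_of_pairwise_inner_eq_zero {ι : Type*} (ψ : ι → L2 d) (h0 : ∀ i, ψ i ≠ 0)
    (h : Pairwise fun i j => inner ℂ (ψ i) (ψ j) = 0) : Countable ι := by
  let v : ι → L2 d := fun i => ((‖ψ i‖⁻¹ : ℝ) : ℂ) • ψ i
  have hv : Orthonormal ℂ v := by
    refine ⟨fun i => ?_, fun i j hij => ?_⟩
    · simp [v, norm_smul, h0 i]
    · simp [v, inner_smul_left, inner_smul_right, h hij]
  have hcount (y : Lattice d) : {i | ψ i y ≠ 0}.Countable := by
    refine (hv.inner_products_summable (lp.single 2 y 1)).countable_support.mono fun i hi => ?_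
    simp only [Set.mem_ofPred_eq] at hi
    simp [v, inner_smul_left, lp.inner_single_right, h0 i, hi]
  rw [← Set.countable_univ_iff]
  refine (Set.countable_iUnion hcount).mono fun i _ => ?_
  by_contra hi
  refine h0 i (lp.ext (funext fun y => ?_))
  simpa using (Set.mem_iUnion.not.1 hi |> not_exists.1) y

/-- The potentials `V` for which some energy has an `ℓ²` solution normalized by `φ x = 1` and a
nonzero `ℓ²` solution `ψ` with `ψ x = 0`. An eigenvalue of multiplicity at least two yields such
a pair for some `x`. -/
def degenerateAt (x : Lattice d) : Set (Lattice d → ℝ) :=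
  {V | ∃ (E : ℂ) (φ ψ : L2 d), SolvesEigenEquation V E φ ∧ SolvesEigenEquation V E ψ ∧
    φ x = 1 ∧ ψ x = 0 ∧ ψ ≠ 0}

/-- Since `ψ` vanishes at `x`, it does not feel the value of the potential there. Distinct values
`v` give distinct energies, hence mutually orthogonal `ψ`. -/
theorem countable_setOf_mem_degenerateAt (x : Lattice d) (U : ℝ → Lattice d → ℝ)
    (hx : ∀ v, U v x = v) (hU : ∀ v w y, y ≠ x → U v y = U w y) :
    {v | U v ∈ degenerateAt x}.Countable := by
  have hall (i : {v | U v ∈ degenerateAt x}) : U i ∈ degenerateAt x := i.2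
  choose E φ ψ hφ hψ hφx hψx hψ0 using hall
  refine Set.countable_coe_iff.1 (countable_of_pairwise_inner_eq_zero ψ hψ0 fun i j hij => ?_)
  -- All `ψ i` are compared as solutions for the single potential `U j`.
  have hψ' : SolvesEigenEquation (U j) (E i) (ψ i) :=
    (hψ i).congr_potential fun y hy => hU _ _ y (by rintro rfl; exact hy (hψx i))
  refine inner_eq_zero_of_solvesEigenEquation (hψ j) hψ' fun hE => hij ?_
  rw [conj_eq_of_solvesEigenEquation (hψ i) (hψ0 i)] at hE
  have hφ' := hφ j
  rw [hE] at hφ'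
  have := eq_at_of_solvesEigenEquation (hφ i) hφ' (hU _ _) (by simp [hφx]) (by simp [hφx])
  rw [hx, hx] at this
  exact Subtype.ext this

/-! ### Measurability of the degenerate set -/

/-- The functions with `∑ ‖φ x‖² ≤ n`, with the topology of pointwise convergence. -/
def sqSumBall (d n : ℕ) : Set (Lattice d → ℂ) :=
  {φ | ∀ s : Finset (Lattice d), ∑ y ∈ s, ‖φ y‖ ^ 2 ≤ n}

theorem isCompact_sqSumBall (n : ℕ) : IsCompact (sqSumBall d n) := by
  refine (isCompact_univ_pi fun _ : Lattice d =>
    isCompact_closedBall (0 : ℂ) n).of_isClosed_subset ?_ fun φ hφ y _ => ?_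
  · simp only [sqSumBall, Set.ofPred_forall]
    exact isClosed_iInter fun s => isClosed_le (by fun_prop) continuous_const
  · have h := hφ {y}
    rw [Finset.sum_singleton] at h
    rw [mem_closedBall_zero_iff]
    rcases Nat.eq_zero_or_pos n with rfl | hn
    · exact (pow_le_pow_iff_left₀ (norm_nonneg _) (by simp) two_ne_zero).1 (by simpa using h)
    · have : (1 : ℝ) ≤ n := by exact_mod_cast hn
      nlinarith [norm_nonneg (φ y)]

theorem memℓp_of_mem_sqSumBall {n : ℕ} {φ : Lattice d → ℂ} (h : φ ∈ sqSumBall d n) :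
    Memℓp φ 2 :=
  memℓp_gen' (C := n) fun s => by simpa using h s

theorem eventually_mem_sqSumBall (φ : L2 d) :
    ∀ᶠ n : ℕ in Filter.atTop, (φ : Lattice d → ℂ) ∈ sqSumBall d n := by
  filter_upwards [Filter.eventually_ge_atTop ⌈‖φ‖ ^ 2⌉₊] with n hn s
  have h := lp.sum_rpow_le_norm_rpow (p := 2) (by norm_num) φ s
  exact le_trans (by simpa using h) (Nat.ceil_le.1 hn)

theorem isClosed_setOf_solvesEigenEquation :
    IsClosed {q : (Lattice d → ℝ) × ℂ × (Lattice d → ℂ) |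
      SolvesEigenEquation q.1 q.2.1 q.2.2} := by
  simp only [SolvesEigenEquation, Set.ofPred_forall, lapFun_eq_sum]
  exact isClosed_iInter fun x => isClosed_eq (by fun_prop) (by fun_prop)

/-- Functions `φ`, `ψ` with bounded `ℓ²` norms and bounded energies range over a set that is compact
for pointwise convergence, so `degenerateAt x` is a countable union of projections of closed sets
along compact factors. -/
theorem measurableSet_degenerateAt (x : Lattice d) : MeasurableSet (degenerateAt x) := by
  let K (n : ℕ) : Set (ℂ × (Lattice d → ℂ) × (Lattice d → ℂ)) :=
    Metric.closedBall 0 n ×ˢ sqSumBall d n ×ˢ sqSumBall d n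
  have hK (n : ℕ) : CompactSpace (K n) := isCompact_iff_compactSpace.1
    ((isCompact_closedBall _ _).prod ((isCompact_sqSumBall n).prod (isCompact_sqSumBall n)))
  let C (n : ℕ) (y : Lattice d) : Set ((Lattice d → ℝ) × K n) :=
    {q | SolvesEigenEquation q.1 q.2.1.1 q.2.1.2.1 ∧ SolvesEigenEquation q.1 q.2.1.1 q.2.1.2.2 ∧
      q.2.1.2.1 x = 1 ∧ q.2.1.2.2 x = 0 ∧ q.2.1.2.2 y = 1}
  have hC (n : ℕ) (y : Lattice d) : IsClosed (C n y) := by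
    refine IsClosed.inter (isClosed_setOf_solvesEigenEquation.preimage
      (f := fun q : (Lattice d → ℝ) × K n => (q.1, q.2.1.1, q.2.1.2.1)) (by fun_prop)) ?_
    refine IsClosed.inter (isClosed_setOf_solvesEigenEquation.preimage
      (f := fun q : (Lattice d → ℝ) × K n => (q.1, q.2.1.1, q.2.1.2.2)) (by fun_prop)) ?_
    exact (isClosed_eq (by fun_prop) continuous_const).inter
      ((isClosed_eq (by fun_prop) continuous_const).inter
        (isClosed_eq (by fun_prop) continuous_const))
  have heq : degenerateAt x = ⋃ (n : ℕ) (y : Lattice d), Prod.fst '' C n y := by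
    ext V
    simp only [Set.mem_iUnion]
    constructor
    · rintro ⟨E, φ, ψ, hφ, hψ, hφx, hψx, hψ0⟩
      obtain ⟨y, hy⟩ : ∃ y, ψ y ≠ 0 := by
        by_contra! h
        exact hψ0 (lp.ext (funext h))
      obtain ⟨n, hn₁, hn₂, hn₃⟩ := ((eventually_mem_sqSumBall φ).and
        ((eventually_mem_sqSumBall ((ψ y)⁻¹ • ψ)).and
          (Filter.eventually_ge_atTop ⌈‖E‖⌉₊))).exists
      refine ⟨n, y, ⟨V, ⟨E, φ, ((ψ y)⁻¹ • ψ : L2 d)⟩, ?_, hn₁, hn₂⟩, ⟨hφ, hψ.smul _, hφx, ?_, ?_⟩,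
        rfl⟩
      · simpa using Nat.ceil_le.1 hn₃
      · simp [hψx]
      · simp [hy]
    · rintro ⟨n, y, ⟨V, ⟨⟨E, φ, ψ⟩, _, hφK, hψK⟩⟩, ⟨hφ, hψ, hφx, hψx, hψy⟩, rfl⟩
      refine ⟨E, ⟨φ, memℓp_of_mem_sqSumBall hφK⟩, ⟨ψ, memℓp_of_mem_sqSumBall hψK⟩, hφ, hψ, hφx,
        hψx, fun h => ?_⟩
      have : ψ y = 0 := congrArg (fun f : L2 d => f y) h
      exact one_ne_zero (hψy.symm.trans this)
  rw [heq]
  exact .iUnion fun n => .iUnion fun y => (isClosedMap_fst_of_compactSpace _ (hC n y)).measurableSet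

/-! ### Almost sure simplicity -/

theorem indepFun_restrict_ne {Ω : Type*} [MeasurableSpace Ω] {P : Measure Ω}
    {ι : Type*} {V : ι → Ω → ℝ} (hm : ∀ x, Measurable (V x)) (hi : iIndepFun V P) (x : ι) :
    IndepFun (fun ω (y : {y // y ≠ x}) => V y ω) (V x) P := by
  have h := indep_iSup_of_disjoint (fun i => (hm i).comap_le) hi.iIndep
    (S := {y | y ≠ x}) (T := {x}) (by simp)
  rw [IndepFun_iff_Indep]
  refine indep_of_indep_of_le_left (indep_of_indep_of_le_right h ?_) ?_
  · exact le_iSup₂_of_le (f := fun i (_ : i ∈ ({x} : Set ι)) => _) x rfl le_rfl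
  · rw [MeasurableSpace.pi, MeasurableSpace.comap_iSup]
    refine iSup_le fun y => ?_
    rw [MeasurableSpace.comap_comp]
    exact le_iSup₂_of_le (f := fun i (_ : i ∈ {y : ι | y ≠ x}) => _) y.1 y.2 le_rfl

/-- This is Fubini's theorem: the law of `V x` has no atoms, so it does not charge the countable set
of values at `x` that are degenerate for the rest of the potential, of which `V x` is
independent. -/
theorem ae_notMem_degenerateAt {Ω : Type*} [MeasurableSpace Ω] {P : Measure Ω}
    [IsProbabilityMeasure P] {V : Lattice d → Ω → ℝ} (hm : ∀ x, Measurable (V x))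
    (hi : iIndepFun V P) (x : Lattice d) [NullSingletonClass (P.map (V x))] :
    ∀ᵐ ω ∂P, (fun y => V y ω) ∉ degenerateAt x := by
  classical
  -- `glue` reassembles a potential from its restriction off `x` and its value at `x`.
  let glue : ({y // y ≠ x} → ℝ) × ℝ → Lattice d → ℝ :=
    fun q y => if h : y = x then q.2 else q.1 ⟨y, h⟩
  have hglue : Measurable glue := by
    refine measurable_pi_lambda _ fun y => ?_
    by_cases h : y = x
    · simpa [glue, h] using measurable_snd
    · simp only [glue, h, dite_false]
      fun_prop
  have hmR : Measurable fun ω (y : {y // y ≠ x}) => V y ω :=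
    measurable_pi_lambda _ fun y => hm y
  have hS := hglue (measurableSet_degenerateAt x)
  have hnull : (P.map fun ω => ((fun y : {y // y ≠ x} => V y ω), V x ω))
      (glue ⁻¹' degenerateAt x) = 0 := by
    rw [(indepFun_iff_map_prod_eq_prod_map_map hmR.aemeasurable (hm x).aemeasurable).1
      (indepFun_restrict_ne hm hi x), Measure.measure_prod_null hS]
    filter_upwards with w
    refine Set.Countable.measure_zero (countable_setOf_mem_degenerateAt x (fun v => glue (w, v))
      (by simp [glue]) fun v v' y hy => by simp [glue, hy]) _
  rw [Measure.map_apply (hmR.prodMk (hm x)) hS] at hnull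
  refine measure_mono_null (fun ω hω => ?_) hnull
  have : glue ((fun y : {y // y ≠ x} => V y ω), V x ω) = fun y => V y ω := by
    ext y
    by_cases h : y = x
    · subst h; simp [glue]
    · simp [glue, h]
  simpa [this] using hω

theorem exists_mem_degenerateAt {V : Lattice d → ℝ} {E : ℂ} {φ₁ φ₂ : L2 d}
    (h₁ : IsEigenfunction (hamiltonian V) E φ₁) (h₂ : IsEigenfunction (hamiltonian V) E φ₂)
    (hli : LinearIndependent ℂ ![φ₁, φ₂]) : ∃ x, V ∈ degenerateAt x := by
  obtain ⟨x, hx⟩ : ∃ x, φ₁ x ≠ 0 := by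
    by_contra! h
    exact h₁.1 (lp.ext (funext h))
  have hs := h₁.solvesEigenEquation.smul (φ₁ x)⁻¹
  refine ⟨x, E, (φ₁ x)⁻¹ • φ₁, φ₂ - (φ₂ x / φ₁ x) • φ₁, hs,
    h₁.solvesEigenEquation.sub_smul h₂.solvesEigenEquation _, ?_, ?_, fun h => ?_⟩
  · simp [hx]
  · change φ₂ x - φ₂ x / φ₁ x * φ₁ x = 0
    rw [div_mul_cancel₀ _ hx, sub_self]
  · have := LinearIndependent.pair_iff.1 hli (-(φ₂ x / φ₁ x)) 1 (by rw [← h]; module)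
    exact one_ne_zero this.2

end Anderson

/-- With probability one, the Anderson Hamiltonian has no eigenvalue with two linearly
independent fast decaying eigenfunctions. -/
theorem mainTheorem1 (d : ℕ) {Ω : Type*} [MeasurableSpace Ω] (P : Measure Ω)
    [IsProbabilityMeasure P] (V : Anderson.Lattice d → Ω → ℝ) (μ : Measure ℝ) (ρ : ℝ → ℝ≥0∞)
    (hV : Anderson.IsAndersonPotential P V μ ρ) :
    ∀ᵐ ω ∂P, ¬ ∃ (E : ℂ) (φ₁ φ₂ : Anderson.L2 d),
      Anderson.IsEigenfunction (Anderson.hamiltonian fun x => V x ω) E φ₁ ∧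
      Anderson.IsEigenfunction (Anderson.hamiltonian fun x => V x ω) E φ₂ ∧
      LinearIndependent ℂ ![φ₁, φ₂] ∧
      Anderson.FastDecaying φ₁ ∧ Anderson.FastDecaying φ₂ := by
  have hatoms (x : Anderson.Lattice d) : NullSingletonClass (P.map (V x)) := by
    rw [hV.law, hV.density]
    exact ⟨fun t => withDensity_absolutelyContinuous _ _ (measure_singleton t)⟩
  filter_upwards [ae_all_iff.2 fun x => Anderson.ae_notMem_degenerateAt hV.measurable hV.indep x]
    with ω hω
  rintro ⟨E, φ₁, φ₂, h₁, h₂, hli, -, -⟩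
  obtain ⟨x, hx⟩ := Anderson.exists_mem_degenerateAt h₁ h₂ hli
  exact hω x hx
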